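/- \textbf{Setting.} Let $(\Omega,\mathcal A,P)$ be a probability space, $Z\subset\mathbb R^u$ compact, and $C(Z,\mathbb R)$ the space of continuous real functions on $Z$ with the uniform norm and its Borel $\sigma$-algebra. Let $(G^i,T^i)_{i\ge 1}$ be an i.i.d. sequence of random elements of $C(Z,\mathbb R)\times\mathbb R^o$. \textbf{Model.} Let $W=W_0\times W_1\times\dots\times W_k$, where each $W_l\subset\mathbb R^{v_l}$ is compact and non-empty, and let $d$ be the Euclidean distance on $W$. Let $\mu$ be a finite Borel measure on $Z$ and let $p,q\in[1,\infty]$ be conjugate exponents. For $1\le l\le k$ let $F_l:W_l\times Z\to\mathbb R$ be such that $F_l(\cdot,x)$ is continuous for every $x\in Z$, $F_l(w_l,\cdot)$ is measurable for every $w_l\in W_l$, and $|F_l(w_l,x)|\le d_l(x)$ for all $w_l,x$, for some $d_l\in L^p(\mu)$. Let $U:W_0\times\mathbb R^k\to\mathbb R^o$ be bounded and uniformly continuous, and for $w\in W$, $g\in C(Z,\mathbb R)$ put $$H(w,g)=U\Big(w_0,\int F_1(w_1,x)g(x)\,d\mu(x),\dots,\int F_k(w_k,x)g(x)\,d\mu(x)\Big).$$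 \textbf{Errors.} Let $c:\mathbb R^o\times\mathbb R^o\to[0,\infty)$ be continuous (for instance a norm distance), and suppose that there is a function $c_{\max}:\mathbb R^o\to\mathbb R$ with $c(t,H(w,g))\le c_{\max}(t)$ for all $w\in W$, $g\in C(Z,\mathbb R)$, $t\in\mathbb R^o$, and with $c_{\max}(T^1)$ integrable. Let $\lambda(w)=E\big(c(T^1,H(w,G^1))\big)$ and let $W^*\subset W$ be the set of minimizers of $\lambda$ on $W$. \textbf{Observations.} For each $i$, let $(X^i_j)_{j\ge1}$ be a sequence of independent random variables with values in $Z$, all $X^i_j$ having the law $\mu$, and let $(\mathcal E^i_j)_{j\ge 1}$ be a sequence of i.i.d. real random variables, independent of the sequence $(X^i_j)_{j\ge1}$, with $E(\mathcal E^i_j)=0$ and $\mathcal E^i_j\in L^q(P)$ (i.e. $E|\mathcal E^i_j|^q<\infty$ when $q<\infty$, and $\mathcal E^i_j$ essentially bounded when $q=\infty$). One observes $Y^i_j=G^i(X^i_j)+\mathcal E^i_j$ for $1\le j\le m^i$. For $n\ge 1$ and sample sizes $m^1,\dots,m^n$ with $m=\min_{1\le i\le n} m^i$, let $$\lambda_n^m(w)=\frac1n\sum_{i=1}^n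 c\Big(T^i,U\Big(w_0,\frac1{m^i}\sum_{j=1}^{m^i}F_1(w_1,X^i_j)Y^i_j,\dots,\frac1{m^i}\sum_{j=1}^{m^i}F_k(w_k,X^i_j)Y^i_j\Big)\Big).$$ \textbf{Theorem.} The error $\lambda(w)$ is the expectation of an integrable random variable for every $w\in W$, $W^*$ is non-empty, every $\lambda_n^m$ has a minimizer on $W$, and, $P$-almost surely, $\lim_{n\to\infty}\lim_{m\to\infty}d(w_n^m,W^*)=0$ for minimizers $w_n^m$ of $\lambda_n^m$ on $W$, in the following sense: $P$-almost surely, for every $\delta>0$ there is $N$ such that for every $n\ge N$ there is $M$ such that, for all sample sizes $m^1,\dots,m^n\ge M$ and every minimizer $w_n^m$ of $\lambda_n^m$ on $W$, one has $d(w_n^m,W^*)<\delta$. -/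

import Mathlib

open MeasureTheory ProbabilityTheory

noncomputable section

/-- `ℝⁿ` with its Euclidean norm. -/
abbrev Eucl (n : ℕ) : Type := EuclideanSpace ℝ (Fin n)

/-- The space of continuous real functions carries its Borel sigma-algebra (for compact `X` the
topology is that of uniform convergence). -/
instance continuousMapMeasurableSpace (X : Type*) [TopologicalSpace X] :
    MeasurableSpace C(X, ℝ) := borel _

instance continuousMapBorelSpace (X : Type*) [TopologicalSpace X] : BorelSpace C(X, ℝ) := ⟨rfl⟩

namespace FunctionalMLP

variable {u o k : ℕ} {v : Fin (k + 1) → ℕ}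

/-- The parameter space `W = W₀ × W₁ × ⋯ × W_k` with the Euclidean distance inherited from
`ℝ^{v₀ + v₁ + ⋯ + v_k}`. -/
abbrev Param (W : (l : Fin (k + 1)) → Set (Eucl (v l))) : Type :=
  PiLp 2 (fun l => W l)

variable {Z : Set (Eucl u)} {W : (l : Fin (k + 1)) → Set (Eucl (v l))}

/-- Output of the parametric functional perceptron on the function `g`:
`H(w, g) = U(w₀, ∫ F₁(w₁, x) g(x) dμ(x), …, ∫ F_k(w_k, x) g(x) dμ(x))`. -/
def output (μ : Measure Z) (F : (l : Fin k) → W l.succ → Z → ℝ)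
    (U : W 0 × (Fin k → ℝ) → Eucl o) (w : Param W) (g : C(Z, ℝ)) : Eucl o :=
  U (w 0, fun l => ∫ x, F l (w l.succ) x * g x ∂μ)

/-- Output of the perceptron when the function is only known through the `m` first of the noisy
evaluations `(x j, y j)`: each integral is replaced by `(1 / m) ∑_{j < m} F_l(w_l, x_j) y_j`. -/
def discreteOutput (F : (l : Fin k) → W l.succ → Z → ℝ) (U : W 0 × (Fin k → ℝ) → Eucl o)
    (w : Param W) (m : ℕ) (x : ℕ → Z) (y : ℕ → ℝ) : Eucl o :=
  U (w 0, fun l => (1 / (m : ℝ)) * ∑ j ∈ Finset.range m, F l (w l.succ) (x j) * y j)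

/-- The expected error `λ(w) = E (c (T, H(w, G)))`. -/
def expectedError {Ω : Type*} [MeasurableSpace Ω] (P : Measure Ω) (μ : Measure Z)
    (F : (l : Fin k) → W l.succ → Z → ℝ) (U : W 0 × (Fin k → ℝ) → Eucl o)
    (c : Eucl o → Eucl o → ℝ) (G : Ω → C(Z, ℝ)) (T : Ω → Eucl o) (w : Param W) : ℝ :=
  ∫ ω, c (T ω) (output μ F U w (G ω)) ∂P

/-- The discretized empirical error `λ_n^m(w)` computed from the targets `t i` and from the `m i`
first noisy evaluations `(x i j, y i j)` of the `i`-th function, `i < n`. -/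
def discreteError (F : (l : Fin k) → W l.succ → Z → ℝ) (U : W 0 × (Fin k → ℝ) → Eucl o)
    (c : Eucl o → Eucl o → ℝ) (n : ℕ) (m : Fin n → ℕ) (t : ℕ → Eucl o) (x : ℕ → ℕ → Z)
    (y : ℕ → ℕ → ℝ) (w : Param W) : ℝ :=
  (1 / (n : ℝ)) * ∑ i : Fin n, c (t i) (discreteOutput F U w (m i) (x i) (y i))

/-- The set of global minimizers of a real function. -/
def minimizers {A : Type*} (f : A → ℝ) : Set A := {a | ∀ b, f a ≤ f b}

end FunctionalMLP

end

/-! Since `W l` is compact, a function of the parameters is a point of a separable Banach space of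
continuous functions, where sup-norm convergence is uniform convergence in the parameters. The
strong law in that space, `strong_law_ae`, thus gives uniform laws directly.

It is used three times. In `ae_forall_tendsto_average_smul` the weights are `g (X j)`; nothing ties
the random function to the design points, so the null set must serve every `g` at once. In
`ae_tendsto_average_noise_smul` the noise averages out. In `ae_tendstoUniformly_average_error` the
empirical error on exact functions converges to the expected error. Hence the discretized error is
uniformly close to a continuous limit, and by compactness (`exists_infDist_minimizers_lt`) its
minimizers are close to those of the limit. -/

open Filter Topology

/-! ### Measurability of maps into `C(K, ℝ)`. -/

section Measurability

variable {α K : Type*} [MeasurableSpace α] [TopologicalSpace K] [CompactSpace K]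
  [SecondCountableTopology K] [T2Space K]

/-- Measurability of a map into `C(K, ℝ)` can be checked pointwise, since the closed balls are
countable intersections of conditions on the values. -/
theorem measurable_continuousMap_of_eval {f : α → C(K, ℝ)}
    (hf : ∀ w, Measurable fun a => f a w) : Measurable f := by
  obtain ⟨S, hSc, hSd⟩ := TopologicalSpace.exists_countable_dense K
  obtain ⟨D, hDc, hDd⟩ := TopologicalSpace.exists_countable_dense C(K, ℝ)
  have hball : ∀ (h : C(K, ℝ)) (r : ℝ), MeasurableSet (f ⁻¹' Metric.closedBall h r) := by
    intro h r
    by_cases hr : 0 ≤ r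
    · have : f ⁻¹' Metric.closedBall h r = ⋂ w ∈ S, {a | dist (f a w) (h w) ≤ r} := by
        ext a
        simp only [Set.mem_preimage, Metric.mem_closedBall, ContinuousMap.dist_le hr,
          Set.mem_iInter, Set.mem_ofPred_eq]
        refine ⟨fun H w _ => H w, fun H w => ?_⟩
        have hcl : IsClosed {w | dist (f a w) (h w) ≤ r} :=
          isClosed_le (by fun_prop) continuous_const
        have := hcl.closure_subset_iff.2 (fun w hw => H w hw : S ⊆ _)
        rw [hSd.closure_eq] at this
        exact this (Set.mem_univ w)
      rw [this]
      exact MeasurableSet.biInter hSc fun w _ =>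
        measurableSet_le ((hf w).dist measurable_const) measurable_const
    · rw [Metric.closedBall_eq_empty.2 (not_le.1 hr)]
      simp
  refine measurable_of_isOpen fun s hs => ?_
  -- Separability reduces an open set to countably many closed balls, with centers in `D` and
  -- rational radii.
  have hs_eq : s = ⋃ h ∈ D, ⋃ r : {r : ℚ // Metric.closedBall h (r : ℝ) ⊆ s},
      Metric.closedBall h (r.1 : ℝ) := by
    ext x
    simp only [Set.mem_iUnion, exists_prop]
    constructor
    · intro hx
      obtain ⟨η, hη, hηs⟩ := Metric.isOpen_iff.1 hs x hx
      obtain ⟨r, hr0, hr⟩ := exists_rat_btwn (half_pos hη)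
      obtain ⟨h, hhD, hh⟩ := hDd.exists_dist_lt x hr0
      refine ⟨h, hhD, ⟨r, fun y hy => hηs ?_⟩, hh.le⟩
      rw [Metric.mem_ball, dist_comm]
      rw [Metric.mem_closedBall, dist_comm] at hy
      linarith [dist_triangle x h y]
    · rintro ⟨h, _, r, hr⟩
      exact r.2 hr
  rw [hs_eq]
  simp only [Set.preimage_iUnion]
  exact MeasurableSet.biUnion hDc fun h _ => MeasurableSet.iUnion fun r => hball h _

end Measurability

/-! ### Stability of minimizers. -/

/-- Minimizers of functions uniformly close to a continuous function on a compact space are close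
to the minimizers of the latter. -/
theorem exists_infDist_minimizers_lt {K : Type*} [PseudoMetricSpace K] [CompactSpace K]
    {f : K → ℝ} (hf : Continuous f) {δ : ℝ} (hδ : 0 < δ) :
    ∃ η > 0, ∀ h : K → ℝ, (∀ w, |h w - f w| < η) → ∀ w ∈ FunctionalMLP.minimizers h,
      Metric.infDist w (FunctionalMLP.minimizers f) < δ := by
  -- `infDist` to the empty set is `0`.
  by_cases hne : (FunctionalMLP.minimizers f).Nonempty
  swap
  · rw [Set.not_nonempty_iff_eq_empty] at hne
    exact ⟨1, one_pos, fun _ _ _ _ => by rw [hne, Metric.infDist_empty]; exact hδ⟩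
  obtain ⟨a, ha⟩ := hne
  have hC : IsCompact {w | δ ≤ Metric.infDist w (FunctionalMLP.minimizers f)} :=
    (isClosed_le continuous_const (Metric.continuous_infDist_pt _)).isCompact
  rcases Set.eq_empty_or_nonempty {w | δ ≤ Metric.infDist w (FunctionalMLP.minimizers f)}
    with h0 | h0
  · refine ⟨1, one_pos, fun _ _ w _ => ?_⟩
    by_contra hw
    exact (h0 ▸ not_lt.1 hw : w ∈ (∅ : Set K))
  · obtain ⟨b, hb, hbmin⟩ := hC.exists_isMinOn h0 hf.continuousOn
    have hab : f a < f b := by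
      refine lt_of_le_of_ne (ha b) fun hab => ?_
      have hbm : b ∈ FunctionalMLP.minimizers f := fun x => hab ▸ ha x
      have hb' : δ ≤ Metric.infDist b (FunctionalMLP.minimizers f) := hb
      rw [Metric.infDist_zero_of_mem hbm] at hb'
      linarith
    -- Here `b` is best among the points at distance at least `δ`. Half the gap keeps `h` larger at
    -- each of these points than at `a`.
    refine ⟨(f b - f a) / 2, by linarith, fun h hh w hw => ?_⟩
    by_contra hwδ
    have h1 : f b ≤ f w := hbmin (not_lt.1 hwδ)
    have h2 := abs_lt.1 (hh w)
    have h3 := abs_lt.1 (hh a)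
    linarith [hw a]

theorem minimizers_nonempty {K : Type*} [TopologicalSpace K] [CompactSpace K] [Nonempty K]
    {f : K → ℝ} (hf : Continuous f) : (FunctionalMLP.minimizers f).Nonempty := by
  obtain ⟨a, -, ha⟩ := isCompact_univ.exists_isMinOn Set.univ_nonempty hf.continuousOn
  exact ⟨a, fun b => ha (Set.mem_univ b)⟩

/-- If `(f₁, f₂)` is independent of `(g₁, g₂)`, `f₁` of `f₂` and `g₁` of `g₂`, then `(f₁, g₁)` is
independent of `(f₂, g₂)`. -/
theorem ProbabilityTheory.IndepFun.prodMk_prodMk_comm {Ω β γ : Type*} [MeasurableSpace Ω]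
    [MeasurableSpace β] [MeasurableSpace γ] {P : Measure Ω} [IsZeroOrProbabilityMeasure P]
    {f₁ f₂ : Ω → β} {g₁ g₂ : Ω → γ} (hf₁ : Measurable f₁) (hf₂ : Measurable f₂)
    (hg₁ : Measurable g₁) (hg₂ : Measurable g₂)
    (hfg : IndepFun (fun ω => (f₁ ω, f₂ ω)) (fun ω => (g₁ ω, g₂ ω)) P)
    (hf : IndepFun f₁ f₂ P) (hg : IndepFun g₁ g₂ P) :
    IndepFun (fun ω => (f₁ ω, g₁ ω)) (fun ω => (f₂ ω, g₂ ω)) P := by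
  have hfg₁ : IndepFun f₁ g₁ P := hfg.comp measurable_fst measurable_fst
  have hfg₂ : IndepFun f₂ g₂ P := hfg.comp measurable_snd measurable_snd
  rw [IndepFun_iff_Indep]
  -- Rectangles form generating π-systems, and on them the measure splits into four factors that can
  -- be regrouped.
  refine IndepSets.indep (hf₁.prodMk hg₁).comap_le (hf₂.prodMk hg₂).comap_le
    (isPiSystem_prod.comap _) (isPiSystem_prod.comap _)
    (by rw [← generateFrom_prod, MeasurableSpace.comap_generateFrom]; rfl)
    (by rw [← generateFrom_prod, MeasurableSpace.comap_generateFrom]; rfl) ?_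
  rw [IndepSets_iff]
  rintro _ _ ⟨_, ⟨s₁, hs₁, t₁, ht₁, rfl⟩, rfl⟩ ⟨_, ⟨s₂, hs₂, t₂, ht₂, rfl⟩, rfl⟩
  have e₁ : (fun ω => (f₁ ω, g₁ ω)) ⁻¹' s₁ ×ˢ t₁ = f₁ ⁻¹' s₁ ∩ g₁ ⁻¹' t₁ := rfl
  have e₂ : (fun ω => (f₂ ω, g₂ ω)) ⁻¹' s₂ ×ˢ t₂ = f₂ ⁻¹' s₂ ∩ g₂ ⁻¹' t₂ := rfl
  have e₃ : (f₁ ⁻¹' s₁ ∩ g₁ ⁻¹' t₁) ∩ (f₂ ⁻¹' s₂ ∩ g₂ ⁻¹' t₂) =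
      (fun ω => (f₁ ω, f₂ ω)) ⁻¹' s₁ ×ˢ s₂ ∩ (fun ω => (g₁ ω, g₂ ω)) ⁻¹' t₁ ×ˢ t₂ :=
    Set.inter_inter_inter_comm ..
  rw [e₁, e₂, e₃, hfg.measure_inter_preimage_eq_mul _ _ (hs₁.prod hs₂) (ht₁.prod ht₂),
    hfg₁.measure_inter_preimage_eq_mul _ _ hs₁ ht₁, hfg₂.measure_inter_preimage_eq_mul _ _ hs₂ ht₂]
  have e₄ : (fun ω => (f₁ ω, f₂ ω)) ⁻¹' s₁ ×ˢ s₂ = f₁ ⁻¹' s₁ ∩ f₂ ⁻¹' s₂ := rfl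
  have e₅ : (fun ω => (g₁ ω, g₂ ω)) ⁻¹' t₁ ×ˢ t₂ = g₁ ⁻¹' t₁ ∩ g₂ ⁻¹' t₂ := rfl
  rw [e₄, e₅, hf.measure_inter_preimage_eq_mul _ _ hs₁ hs₂,
    hg.measure_inter_preimage_eq_mul _ _ ht₁ ht₂]
  ring

/-! ### Strong laws in a separable Banach space. -/

section LargeNumbers

variable {Ω Z E : Type*} [MeasurableSpace Ω] {P : Measure Ω}
  [TopologicalSpace Z] [CompactSpace Z] [MeasurableSpace Z] [OpensMeasurableSpace Z]
  [NormedAddCommGroup E] [NormedSpace ℝ E]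
  {μ : Measure Z} {Φ : Z → E}

theorem integrable_continuousMap_smul (hΦ : Integrable Φ μ) (g : C(Z, ℝ)) :
    Integrable (fun z => g z • Φ z) μ :=
  hΦ.bdd_smul ‖g‖ g.continuous.measurable.aestronglyMeasurable
    (ae_of_all _ fun z => g.norm_coe_le_norm z)

/-- The map is Lipschitz with constant `∫ ‖Φ‖`. -/
theorem continuous_integral_continuousMap_smul (hΦ : Integrable Φ μ) :
    Continuous fun g : C(Z, ℝ) => ∫ z, g z • Φ z ∂μ := by
  refine (LipschitzWith.of_dist_le_mul (K := (∫ z, ‖Φ z‖ ∂μ).toNNReal) fun g g' => ?_).continuous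
  rw [dist_eq_norm, dist_eq_norm, ← integral_sub (integrable_continuousMap_smul hΦ g)
    (integrable_continuousMap_smul hΦ g'),
    Real.coe_toNNReal _ (integral_nonneg fun z => norm_nonneg _), ← integral_mul_const]
  refine norm_integral_le_of_norm_le (hΦ.norm.mul_const _) (ae_of_all _ fun z => ?_)
  rw [← sub_smul, norm_smul, mul_comm]
  exact mul_le_mul_of_nonneg_left ((g - g').norm_coe_le_norm z) (norm_nonneg _)

variable [CompleteSpace E] [MeasurableSpace E] [BorelSpace E] [SecondCountableTopology E]

/-- Strong law of large numbers for `g (X j) • Φ (X j)`, with an exceptional null set that does not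
depend on the continuous function `g`. -/
theorem ae_forall_tendsto_average_smul [SecondCountableTopology C(Z, ℝ)]
    {X : ℕ → Ω → Z} (hX : ∀ j, Measurable (X j)) (hind : Pairwise fun i j => IndepFun (X i) (X j) P)
    (hlaw : ∀ j, P.map (X j) = μ) (hΦm : Measurable Φ) (hΦ : Integrable Φ μ) :
    ∀ᵐ ω ∂P, ∀ g : C(Z, ℝ), Tendsto
      (fun n : ℕ => (n : ℝ)⁻¹ • ∑ j ∈ Finset.range n, g (X j ω) • Φ (X j ω)) atTop
      (𝓝 (∫ z, g z • Φ z ∂μ)) := by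
  have hident : ∀ j, IdentDistrib (X j) (X 0) P P := fun j =>
    ⟨(hX j).aemeasurable, (hX 0).aemeasurable, by rw [hlaw, hlaw]⟩
  have hfix : ∀ g : C(Z, ℝ), ∀ᵐ ω ∂P, Tendsto
      (fun n : ℕ => (n : ℝ)⁻¹ • ∑ j ∈ Finset.range n, g (X j ω) • Φ (X j ω)) atTop
      (𝓝 (∫ z, g z • Φ z ∂μ)) := by
    intro g
    have hψm : Measurable fun z => g z • Φ z := g.continuous.measurable.smul hΦm
    have hψ := integrable_continuousMap_smul hΦ g
    have := strong_law_ae (μ := P) (fun j => (fun z => g z • Φ z) ∘ X j)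
      ((integrable_map_measure hψm.aestronglyMeasurable (hX 0).aemeasurable).1
        ((hlaw 0).symm ▸ hψ))
      (fun i j hij => (hind hij).comp hψm hψm) (fun j => (hident j).comp hψm)
    have hint : ∫ ω, ((fun z => g z • Φ z) ∘ X 0) ω ∂P = ∫ z, g z • Φ z ∂μ := by
      rw [← hlaw 0, integral_map (hX 0).aemeasurable hψm.aestronglyMeasurable]
      rfl
    rw [hint] at this
    exact this
  -- Convergence of these averages bounds them along the path; the bound `C` is a Lipschitz constant
  -- in `g` common to all `n`.
  have hnorm : ∀ᵐ ω ∂P, Tendsto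
      (fun n : ℕ => (n : ℝ)⁻¹ • ∑ j ∈ Finset.range n, ‖Φ (X j ω)‖) atTop
      (𝓝 (∫ ω, ((fun z => ‖Φ z‖) ∘ X 0) ω ∂P)) :=
    strong_law_ae (μ := P) (fun j => (fun z => ‖Φ z‖) ∘ X j)
      ((integrable_map_measure hΦm.norm.aestronglyMeasurable (hX 0).aemeasurable).1
        ((hlaw 0).symm ▸ hΦ.norm))
      (fun i j hij => (hind hij).comp hΦm.norm hΦm.norm) (fun j => (hident j).comp hΦm.norm)
  obtain ⟨D, hDc, hDd⟩ := TopologicalSpace.exists_countable_dense C(Z, ℝ)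
  filter_upwards [(ae_ball_iff hDc).2 fun g _ => hfix g, hnorm] with ω hω hωn g
  obtain ⟨C, hC⟩ := hωn.bddAbove_range
  have hequi : Equicontinuous fun (n : ℕ) (g : C(Z, ℝ)) =>
      (n : ℝ)⁻¹ • ∑ j ∈ Finset.range n, g (X j ω) • Φ (X j ω) := by
    refine (LipschitzWith.uniformEquicontinuous _ C.toNNReal fun n => ?_).equicontinuous
    refine LipschitzWith.of_dist_le_mul fun g g' => ?_
    rw [dist_eq_norm, dist_eq_norm, ← smul_sub, ← Finset.sum_sub_distrib, norm_smul,
      Real.norm_of_nonneg (by positivity)]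
    calc (n : ℝ)⁻¹ * ‖∑ j ∈ Finset.range n, (g (X j ω) • Φ (X j ω) - g' (X j ω) • Φ (X j ω))‖
        ≤ (n : ℝ)⁻¹ * ∑ j ∈ Finset.range n, ‖Φ (X j ω)‖ * ‖g - g'‖ := by
          refine mul_le_mul_of_nonneg_left (norm_sum_le_of_le _ fun j _ => ?_) (by positivity)
          rw [← sub_smul, norm_smul, mul_comm]
          exact mul_le_mul_of_nonneg_left ((g - g').norm_coe_le_norm _) (norm_nonneg _)
      _ = ((n : ℝ)⁻¹ • ∑ j ∈ Finset.range n, ‖Φ (X j ω)‖) * ‖g - g'‖ := by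
          rw [← Finset.sum_mul, smul_eq_mul, mul_assoc]
      _ ≤ C.toNNReal * ‖g - g'‖ := mul_le_mul_of_nonneg_right
          ((hC ⟨n, rfl⟩).trans (Real.le_coe_toNNReal C)) (norm_nonneg _)
  -- For an equicontinuous sequence, the set of `g` where it converges to a continuous limit is
  -- closed; it contains the dense set `D`.
  have hcl := (hequi.isClosed_setOfPred_tendsto (l := atTop)
    (continuous_integral_continuousMap_smul hΦ)).closure_subset_iff.2 hω
  rw [hDd.closure_eq] at hcl
  exact hcl (Set.mem_univ g)

end LargeNumbers

/-- Averages of centered noise `ε j` with independent weights `Φ (X j)` vanish asymptotically. -/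
theorem ae_tendsto_average_noise_smul {Ω Z E : Type*} [MeasurableSpace Ω] {P : Measure Ω}
    [IsProbabilityMeasure P] [MeasurableSpace Z] [NormedAddCommGroup E] [NormedSpace ℝ E]
    [CompleteSpace E] [MeasurableSpace E] [BorelSpace E] [SecondCountableTopology E]
    {μ : Measure Z} {Φ : Z → E}
    {X : ℕ → Ω → Z} {ε : ℕ → Ω → ℝ}
    (hX : ∀ j, Measurable (X j)) (hind : Pairwise fun i j => IndepFun (X i) (X j) P)
    (hlaw : ∀ j, P.map (X j) = μ) (hΦm : Measurable Φ) (hΦ : Integrable Φ μ)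
    (hε : ∀ j, Measurable (ε j)) (hεind : Pairwise fun i j => IndepFun (ε i) (ε j) P)
    (hεident : ∀ j, IdentDistrib (ε j) (ε 0) P P)
    (hXε : IndepFun (fun ω j => ε j ω) (fun ω j => X j ω) P)
    (hεint : Integrable (ε 0) P) (hmean : ∫ ω, ε 0 ω ∂P = 0) :
    ∀ᵐ ω ∂P, Tendsto
      (fun n : ℕ => (n : ℝ)⁻¹ • ∑ j ∈ Finset.range n, ε j ω • Φ (X j ω)) atTop (𝓝 0) := by
  have hident : ∀ j, IdentDistrib (X j) (X 0) P P := fun j =>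
    ⟨(hX j).aemeasurable, (hX 0).aemeasurable, by rw [hlaw, hlaw]⟩
  have hεX : ∀ j, IndepFun (ε j) (X j) P := fun j =>
    hXε.comp (measurable_pi_apply j) (measurable_pi_apply j)
  have hεΦ : IndepFun (ε 0) (Φ ∘ X 0) P := (hεX 0).comp measurable_id hΦm
  have hΦX : Integrable (Φ ∘ X 0) P :=
    (integrable_map_measure hΦm.aestronglyMeasurable (hX 0).aemeasurable).1 ((hlaw 0).symm ▸ hΦ)
  have hm : Measurable fun a : ℝ × Z => a.1 • Φ a.2 :=
    measurable_fst.smul (hΦm.comp measurable_snd)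
  have := strong_law_ae (μ := P)
    (fun j => (fun a : ℝ × Z => a.1 • Φ a.2) ∘ fun ω => (ε j ω, X j ω))
    (hεΦ.integrable_smul hεint hΦX)
    -- Etemadi's form of the strong law needs only pairwise independence of the pairs `(ε j, X j)`.
    (fun i j hij => (IndepFun.prodMk_prodMk_comm (hε i) (hε j) (hX i) (hX j)
      (hXε.comp ((measurable_pi_apply i).prodMk (measurable_pi_apply j))
        ((measurable_pi_apply i).prodMk (measurable_pi_apply j)))
      (hεind hij) (hind hij)).comp hm hm)
    (fun j => ((hεident j).prodMk (hident j) (hεX j) (hεX 0)).comp hm)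
  have hint : ∫ ω, ((fun a : ℝ × Z => a.1 • Φ a.2) ∘ fun ω => (ε 0 ω, X 0 ω)) ω ∂P = 0 := by
    have h := hεΦ.integral_smul_eq_smul_integral hεint.aestronglyMeasurable
      hΦX.aestronglyMeasurable
    rw [hmean, zero_smul] at h
    exact h
  rw [hint] at this
  exact this

/-! ### Integrands as maps into `C(K, ℝ)`. -/

noncomputable section

/-- A function `F w z` that is continuous in `w`, as a family of continuous functions of `w`. -/
def continuousFamily {K Z : Type*} [TopologicalSpace K] (F : K → Z → ℝ)
    (hF : ∀ z, Continuous fun w => F w z) (z : Z) : C(K, ℝ) := ⟨fun w => F w z, hF z⟩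

section Family

variable {K Z : Type*} [TopologicalSpace K] [CompactSpace K] [T2Space K]
  [SecondCountableTopology K] [MeasurableSpace Z] {F : K → Z → ℝ}
  (hF : ∀ z, Continuous fun w => F w z)

theorem measurable_continuousFamily (hFm : ∀ w, Measurable (F w)) :
    Measurable (continuousFamily F hF) :=
  measurable_continuousMap_of_eval hFm

/-- The envelope `d` does not depend on `w`, so it dominates the sup norm; with `K` nonempty, `0 ≤
d` is automatic. -/
theorem integrable_continuousFamily [Nonempty K] (hFm : ∀ w, Measurable (F w)) {μ : Measure Z}
    {d : Z → ℝ} (hd : Integrable d μ) (hFd : ∀ w z, |F w z| ≤ d z) :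
    Integrable (continuousFamily F hF) μ :=
  hd.mono' (measurable_continuousFamily hF hFm).aestronglyMeasurable
    (ae_of_all _ fun z => (ContinuousMap.norm_le_of_nonempty _).2 fun w => hFd w z)

end Family

/-! ### Uniform convergence of outputs and errors. -/

namespace FunctionalMLP

variable {u o k : ℕ} {v : Fin (k + 1) → ℕ} {Z : Set (Eucl u)}
  {W : (l : Fin (k + 1)) → Set (Eucl (v l))} {μ : Measure Z}
  {F : (l : Fin k) → W l.succ → Z → ℝ} {U : W 0 × (Fin k → ℝ) → Eucl o}
  {c : Eucl o → Eucl o → ℝ}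

theorem compactSpace_param (hW : ∀ l, IsCompact (W l)) : CompactSpace (Param W) := by
  have := fun l => isCompact_iff_compactSpace.1 (hW l)
  exact (PiLp.homeomorph 2 fun l => W l).symm.compactSpace

theorem nonempty_param (hWne : ∀ l, (W l).Nonempty) : Nonempty (Param W) :=
  ⟨WithLp.toLp 2 fun l => ⟨_, (hWne l).some_mem⟩⟩

theorem continuous_param_apply (l : Fin (k + 1)) : Continuous fun w : Param W => w l :=
  PiLp.continuous_apply 2 (fun l => W l) l

theorem continuous_discreteOutput (hF : ∀ l z, Continuous fun w => F l w z)
    (hU : Continuous U) (m : ℕ) (x : ℕ → Z) (y : ℕ → ℝ) :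
    Continuous fun w : Param W => discreteOutput F U w m x y := by
  refine hU.comp ((continuous_param_apply 0).prodMk (continuous_pi fun l => ?_))
  exact continuous_const.mul (continuous_finsetSum _ fun j _ =>
    ((hF l (x j)).comp (continuous_param_apply l.succ)).mul continuous_const)

theorem continuous_discreteError (hF : ∀ l z, Continuous fun w => F l w z)
    (hU : Continuous U) (hc : Continuous fun a : Eucl o × Eucl o => c a.1 a.2) (n : ℕ)
    (m : Fin n → ℕ) (t : ℕ → Eucl o) (x : ℕ → ℕ → Z) (y : ℕ → ℕ → ℝ) :
    Continuous (discreteError F U c n m t x y) :=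
  continuous_const.mul (continuous_finsetSum _ fun i _ =>
    hc.comp (continuous_const.prodMk (continuous_discreteOutput hF hU (m i) (x i) (y i))))

section Output

variable [∀ l, CompactSpace (W l)] (hF : ∀ l z, Continuous fun w => F l w z)
  (hint : ∀ l, Integrable (continuousFamily (F l) (hF l)) μ)

include hint

/-- Evaluation at `w` is a continuous linear map, so it commutes with the Bochner integral. -/
theorem integral_continuousFamily_apply [CompactSpace Z] (l : Fin k) (g : C(Z, ℝ))
    (w : W l.succ) :
    (∫ x, g x • continuousFamily (F l) (hF l) x ∂μ) w = ∫ x, F l w x * g x ∂μ := by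
  rw [ContinuousMap.integral_apply (integrable_continuousMap_smul (hint l) g)]
  exact integral_congr_ae (ae_of_all _ fun x => mul_comm _ _)

theorem continuous_output [CompactSpace Z] (hU : Continuous U) (g : C(Z, ℝ)) :
    Continuous fun w : Param W => output μ F U w g := by
  refine hU.comp ((continuous_param_apply 0).prodMk (continuous_pi fun l => ?_))
  simp_rw [← integral_continuousFamily_apply hF hint]
  exact (ContinuousMap.continuous _).comp (continuous_param_apply l.succ)

theorem continuous_output_right [CompactSpace Z] (hU : Continuous U) (w : Param W) :
    Continuous fun g : C(Z, ℝ) => output μ F U w g := by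
  refine hU.comp (continuous_const.prodMk (continuous_pi fun l => ?_))
  simp_rw [← integral_continuousFamily_apply hF hint]
  exact (continuous_eval_const (F := C(W l.succ, ℝ)) (w l.succ)).comp
    (continuous_integral_continuousMap_smul (hint l))

/-- If the averages of `y j • F_l(·, x j)` converge uniformly to the integrals of `g F_l(·, x)`,
then the errors of the discretized outputs converge uniformly in the parameters. -/
theorem tendstoUniformly_error_discreteOutput [CompactSpace Z] (hU : UniformContinuous U) {B : ℝ}
    (hB : ∀ a, ‖U a‖ ≤ B) (hc : Continuous fun a : Eucl o × Eucl o => c a.1 a.2) (t : Eucl o)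
    (g : C(Z, ℝ)) {x : ℕ → Z} {y : ℕ → ℝ}
    (h : ∀ l, Tendsto (fun m : ℕ => (m : ℝ)⁻¹ • ∑ j ∈ Finset.range m,
      y j • continuousFamily (F l) (hF l) (x j)) atTop
      (𝓝 (∫ x, g x • continuousFamily (F l) (hF l) x ∂μ))) :
    TendstoUniformly (fun (m : ℕ) (w : Param W) => c t (discreteOutput F U w m x y))
      (fun w => c t (output μ F U w g)) atTop := by
  have hcoord : ∀ l, TendstoUniformly
      (fun (m : ℕ) (w : Param W) =>
        (1 / (m : ℝ)) * ∑ j ∈ Finset.range m, F l (w l.succ) (x j) * y j)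
      (fun w => ∫ x, F l (w l.succ) x * g x ∂μ) atTop := by
    intro l
    have := (ContinuousMap.tendsto_iff_tendstoUniformly.1 (h l)).comp
      fun w : Param W => w l.succ
    convert this using 3 with m
    · simp [continuousFamily, mul_comm]
    · exact (integral_continuousFamily_apply hF hint l g _).symm
  have hpair : TendstoUniformly
      (fun (m : ℕ) (w : Param W) => ((w 0, fun l =>
        (1 / (m : ℝ)) * ∑ j ∈ Finset.range m, F l (w l.succ) (x j) * y j) :
          W 0 × (Fin k → ℝ)))
      (fun w => (w 0, fun l => ∫ x, F l (w l.succ) x * g x ∂μ)) atTop := by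
    rw [Metric.tendstoUniformly_iff]
    intro η hη
    filter_upwards [eventually_all.2 fun l => Metric.tendstoUniformly_iff.1 (hcoord l) η hη]
      with m hm w
    rw [Prod.dist_eq, dist_self]
    exact max_lt hη ((dist_pi_lt_iff hη).2 fun l => hm l w)
  -- `c t` is merely continuous, but bounded `U` confines all outputs to a compact ball.
  have hcu : UniformContinuousOn (c t) (Metric.closedBall 0 B) :=
    (isCompact_closedBall _ _).uniformContinuousOn_of_continuous
      (hc.comp (continuous_const.prodMk continuous_id)).continuousOn
  exact UniformContinuousOn.comp_tendstoUniformly (s := Metric.closedBall 0 B)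
    (fun m w => mem_closedBall_zero_iff.2 (hB _)) (fun w => mem_closedBall_zero_iff.2 (hB _)) hcu
    (hU.comp_tendstoUniformly hpair)

end Output

/-- Uniformly close individual errors give uniformly close average errors. -/
theorem exists_forall_abs_discreteError_sub_le {t : ℕ → Eucl o} {x : ℕ → ℕ → Z} {y : ℕ → ℕ → ℝ}
    {g : ℕ → C(Z, ℝ)}
    (h : ∀ i, TendstoUniformly
      (fun (m : ℕ) (w : Param W) => c (t i) (discreteOutput F U w m (x i) (y i)))
      (fun w => c (t i) (output μ F U w (g i))) atTop)
    (n : ℕ) {η : ℝ} (hη : 0 < η) :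
    ∃ M : ℕ, ∀ m : Fin n → ℕ, (∀ i, M ≤ m i) → ∀ w,
      |discreteError F U c n m t x y w -
        (n : ℝ)⁻¹ * ∑ i ∈ Finset.range n, c (t i) (output μ F U w (g i))| ≤ η := by
  -- Only `n` functions occur, so one threshold `M` serves them all; it depends on `n`.
  have h' := eventually_all.2 fun i : Fin n => Metric.tendstoUniformly_iff.1 (h i) η hη
  obtain ⟨M, hM⟩ := eventually_atTop.1 h'
  have hM' : ∀ (i : Fin n) (m : ℕ), M ≤ m → ∀ w,
      |c (t i) (discreteOutput F U w m (x i) (y i)) - c (t i) (output μ F U w (g i))| ≤ η :=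
    fun i m hm w => by
      have := (hM m hm i w).le
      rwa [dist_comm, Real.dist_eq] at this
  refine ⟨M, fun m hm w => ?_⟩
  rw [discreteError, Finset.sum_range, one_div, ← mul_sub, ← Finset.sum_sub_distrib, abs_mul,
    abs_of_nonneg (by positivity)]
  calc (n : ℝ)⁻¹ * |∑ i : Fin n, (c (t i) (discreteOutput F U w (m i) (x i) (y i)) -
        c (t i) (output μ F U w (g i)))|
      ≤ (n : ℝ)⁻¹ * (n * η) := by
        refine mul_le_mul_of_nonneg_left ((Finset.abs_sum_le_sum_abs _ _).trans ?_) (by positivity)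
        refine (Finset.sum_le_sum fun i _ => hM' i (m i) (hm i) w).trans ?_
        simp
    _ ≤ η := by
        rcases eq_or_ne n 0 with rfl | hn
        · simpa using hη.le
        · rw [inv_mul_cancel_left₀ (by exact_mod_cast hn)]

variable {Ω : Type*} [MeasurableSpace Ω] {P : Measure Ω}

section ErrorFamily

variable [CompactSpace Z] [∀ l, CompactSpace (W l)] (hF : ∀ l z, Continuous fun w => F l w z)
  (hint : ∀ l, Integrable (continuousFamily (F l) (hF l)) μ) (hU : Continuous U)
  (hc : Continuous fun a : Eucl o × Eucl o => c a.1 a.2)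

/-- The error on the functional observation `g` with target `t`, as a continuous function of the
parameters. -/
def errorFamily (a : C(Z, ℝ) × Eucl o) : C(Param W, ℝ) :=
  ⟨fun w => c a.2 (output μ F U w a.1),
    hc.comp (continuous_const.prodMk (continuous_output hF hint hU a.1))⟩

theorem measurable_errorFamily : Measurable (errorFamily hF hint hU hc) := by
  have := compactSpace_param fun l =>
    isCompact_iff_compactSpace.2 (inferInstance : CompactSpace (W l))
  refine measurable_continuousMap_of_eval fun w => ?_
  exact hc.measurable.comp (measurable_snd.prodMk
    ((continuous_output_right hF hint hU w).measurable.comp measurable_fst))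

/-- As `cmax` depends neither on `w` nor on `g`, it dominates the sup norm of the error over all
parameters. -/
theorem integrable_errorFamily [CompactSpace (Param W)] [Nonempty (Param W)]
    (hc0 : ∀ s t, 0 ≤ c s t) {cmax : Eucl o → ℝ}
    (hcmax : ∀ (w : Param W) (g : C(Z, ℝ)) (t : Eucl o), c t (output μ F U w g) ≤ cmax t)
    {G : Ω → C(Z, ℝ)} {T : Ω → Eucl o} (hG : Measurable G) (hT : Measurable T)
    (hcmax_int : Integrable (fun ω => cmax (T ω)) P) :
    Integrable (fun ω => errorFamily hF hint hU hc (G ω, T ω)) P := by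
  refine hcmax_int.mono' ((measurable_errorFamily hF hint hU hc).comp
    (hG.prodMk hT)).aestronglyMeasurable (ae_of_all _ fun ω => ?_)
  refine (ContinuousMap.norm_le_of_nonempty _).2 fun w => ?_
  exact (Real.norm_of_nonneg (hc0 _ _)).trans_le (hcmax w (G ω) (T ω))

/-- Uniform strong law of large numbers for the errors. -/
theorem ae_tendstoUniformly_average_error [CompactSpace (Param W)]
    {G : ℕ → Ω → C(Z, ℝ)} {T : ℕ → Ω → Eucl o}
    (hind : iIndepFun (fun i ω => (G i ω, T i ω)) P)
    (hident : ∀ i, IdentDistrib (fun ω => (G i ω, T i ω)) (fun ω => (G 0 ω, T 0 ω)) P P)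
    (hint' : Integrable (fun ω => errorFamily hF hint hU hc (G 0 ω, T 0 ω)) P) :
    ∀ᵐ ω ∂P, TendstoUniformly (fun (n : ℕ) (w : Param W) =>
        (n : ℝ)⁻¹ * ∑ i ∈ Finset.range n, c (T i ω) (output μ F U w (G i ω)))
      (expectedError P μ F U c (G 0) (T 0)) atTop := by
  have hm := measurable_errorFamily hF hint hU hc
  filter_upwards [strong_law_ae (μ := P)
    (fun i => errorFamily hF hint hU hc ∘ fun ω => (G i ω, T i ω)) hint'
    (fun i j hij => (hind.indepFun hij).comp hm hm) (fun i => (hident i).comp hm)] with ω hω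
  have := ContinuousMap.tendsto_iff_tendstoUniformly.1 hω
  convert this using 3 with n w
  · simp [errorFamily]
  · exact funext fun w => (ContinuousMap.integral_apply hint' w).symm

end ErrorFamily

end FunctionalMLP
end

/-! ### Consistency of the minimizers. -/

theorem theorem1
    {Ω : Type*} [MeasurableSpace Ω] (P : Measure Ω) [IsProbabilityMeasure P]
    {u o k : ℕ}
    -- functional observations and targets
    (Z : Set (Eucl u)) (hZ : IsCompact Z)
    (G : ℕ → Ω → C(Z, ℝ)) (T : ℕ → Ω → Eucl o)
    (hG : ∀ i, Measurable (G i)) (hT : ∀ i, Measurable (T i))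
    (hGT_indep : iIndepFun (fun i ω => (G i ω, T i ω)) P)
    (hGT_ident : ∀ i, IdentDistrib (fun ω => (G i ω, T i ω)) (fun ω => (G 0 ω, T 0 ω)) P P)
    -- parametric model
    (v : Fin (k + 1) → ℕ) (W : (l : Fin (k + 1)) → Set (Eucl (v l)))
    (hW : ∀ l, IsCompact (W l)) (hWne : ∀ l, (W l).Nonempty)
    (μ : Measure Z) (p q : ENNReal) (hpq : p.HolderConjugate q)
    (F : (l : Fin k) → W l.succ → Z → ℝ)
    (hF_cont : ∀ l x, Continuous (fun w => F l w x))
    (hF_meas : ∀ l w, Measurable (F l w))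
    (d : Fin k → Z → ℝ) (hd : ∀ l, MemLp (d l) p μ)
    (hF_dom : ∀ l w x, |F l w x| ≤ d l x)
    (U : W 0 × (Fin k → ℝ) → Eucl o)
    (hU_cont : UniformContinuous U) (hU_bdd : ∃ B : ℝ, ∀ a, ‖U a‖ ≤ B)
    -- error function and its domination
    (c : Eucl o → Eucl o → ℝ) (hc_cont : Continuous (fun a : Eucl o × Eucl o => c a.1 a.2))
    (hc_nonneg : ∀ s t, 0 ≤ c s t)
    (cmax : Eucl o → ℝ)
    (hcmax : ∀ (w : FunctionalMLP.Param W) (g : C(Z, ℝ)) (t : Eucl o),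
      c t (FunctionalMLP.output μ F U w g) ≤ cmax t)
    (hcmax_int : Integrable (fun ω => cmax (T 0 ω)) P)
    -- observation points
    (X : ℕ → ℕ → Ω → Z) (hX : ∀ i j, Measurable (X i j))
    (hX_indep : ∀ i, iIndepFun (X i) P)
    (hX_law : ∀ i j, P.map (X i j) = μ)
    -- measurement errors
    (ε : ℕ → ℕ → Ω → ℝ) (hε : ∀ i j, Measurable (ε i j))
    (hε_indep : ∀ i, iIndepFun (ε i) P)
    (hε_ident : ∀ i j, IdentDistrib (ε i j) (ε i 0) P P)
    (hXε : ∀ i, IndepFun (fun ω j => ε i j ω) (fun ω j => X i j ω) P)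
    (hε_mean : ∀ i j, ∫ ω, ε i j ω ∂P = 0)
    (hε_mom : ∀ i j, MemLp (ε i j) q P) :
    -- the expected error is finite and has minimizers
    (∀ w : FunctionalMLP.Param W,
      Integrable (fun ω => c (T 0 ω) (FunctionalMLP.output μ F U w (G 0 ω))) P) ∧
    (FunctionalMLP.minimizers
      (FunctionalMLP.expectedError P μ F U c (G 0) (T 0))).Nonempty ∧
    -- the discretized empirical errors have minimizers
    (∀ (ω : Ω) (n : ℕ) (m : Fin n → ℕ),
      (FunctionalMLP.minimizers (FunctionalMLP.discreteError F U c n m (fun i => T i ω)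
        (fun i j => X i j ω) (fun i j => G i ω (X i j ω) + ε i j ω))).Nonempty) ∧
    -- almost surely, `d(w_n^m, W*)` tends to `0` as `m → ∞` and then `n → ∞`, whatever the
    -- choice of the minimizers `w_n^m` and of the numbers of observations `m i ≥ M`
    (∀ᵐ ω ∂P, ∀ δ : ℝ, 0 < δ → ∃ N : ℕ, ∀ n : ℕ, N ≤ n → ∃ M : ℕ,
      ∀ m : Fin n → ℕ, (∀ i, M ≤ m i) →
        ∀ w ∈ FunctionalMLP.minimizers (FunctionalMLP.discreteError F U c n m (fun i => T i ω)
          (fun i j => X i j ω) (fun i j => G i ω (X i j ω) + ε i j ω)),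
          Metric.infDist w (FunctionalMLP.minimizers
            (FunctionalMLP.expectedError P μ F U c (G 0) (T 0))) < δ) := by

  have : CompactSpace Z := isCompact_iff_compactSpace.1 hZ
  have hWc : ∀ l, CompactSpace (W l) := fun l => isCompact_iff_compactSpace.1 (hW l)
  have hWn : ∀ l, Nonempty (W l) := fun l => (hWne l).to_subtype
  have : CompactSpace (FunctionalMLP.Param W) := FunctionalMLP.compactSpace_param hW
  have : Nonempty (FunctionalMLP.Param W) := FunctionalMLP.nonempty_param hWne
  -- As a law, `μ` has mass `1`, so `d l ∈ L^p` with `p ≥ 1` is integrable.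
  have : IsProbabilityMeasure μ :=
    hX_law 0 0 ▸ Measure.isProbabilityMeasure_map (hX 0 0).aemeasurable
  have hU := hU_cont.continuous
  have hint : ∀ l, Integrable (continuousFamily (F l) (hF_cont l)) μ := fun l =>
    integrable_continuousFamily (hF_cont l) (hF_meas l)
      ((hd l).integrable (ENNReal.HolderTriple.le p q 1)) (hF_dom l)
  have herr : Integrable (fun ω =>
      FunctionalMLP.errorFamily hF_cont hint hU hc_cont (G 0 ω, T 0 ω)) P :=
    FunctionalMLP.integrable_errorFamily hF_cont hint hU hc_cont hc_nonneg hcmax (hG 0) (hT 0)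
      hcmax_int
  have hcont : Continuous (FunctionalMLP.expectedError P μ F U c (G 0) (T 0)) := by
    have := (∫ ω, FunctionalMLP.errorFamily hF_cont hint hU hc_cont (G 0 ω, T 0 ω) ∂P).continuous
    convert this using 1
    funext w
    exact (ContinuousMap.integral_apply herr w).symm
  refine ⟨fun w => (ContinuousMap.evalCLM ℝ w).integrable_comp herr, minimizers_nonempty hcont,
    fun ω n m => minimizers_nonempty
      (FunctionalMLP.continuous_discreteError hF_cont hU hc_cont n m _ _ _), ?_⟩
  obtain ⟨B, hB⟩ := hU_bdd
  have hsample : ∀ᵐ ω ∂P, ∀ i l, ∀ g : C(Z, ℝ), Tendsto (fun m : ℕ => (m : ℝ)⁻¹ •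
      ∑ j ∈ Finset.range m, g (X i j ω) • continuousFamily (F l) (hF_cont l) (X i j ω)) atTop
      (𝓝 (∫ x, g x • continuousFamily (F l) (hF_cont l) x ∂μ)) :=
    ae_all_iff.2 fun i => ae_all_iff.2 fun l => ae_forall_tendsto_average_smul (hX i)
      (fun _ _ h => (hX_indep i).indepFun h) (hX_law i)
      (measurable_continuousFamily _ (hF_meas l)) (hint l)
  have hnoise : ∀ᵐ ω ∂P, ∀ i l, Tendsto (fun m : ℕ => (m : ℝ)⁻¹ •
      ∑ j ∈ Finset.range m, ε i j ω • continuousFamily (F l) (hF_cont l) (X i j ω)) atTop (𝓝 0) :=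
    ae_all_iff.2 fun i => ae_all_iff.2 fun l => ae_tendsto_average_noise_smul (hX i)
      (fun _ _ h => (hX_indep i).indepFun h) (hX_law i)
      (measurable_continuousFamily _ (hF_meas l)) (hint l) (hε i)
      (fun _ _ h => (hε_indep i).indepFun h) (hε_ident i) (hXε i)
      ((hε_mom i 0).integrable (ENNReal.HolderTriple.le q p 1)) (hε_mean i 0)
  filter_upwards [hsample, hnoise, FunctionalMLP.ae_tendstoUniformly_average_error hF_cont hint hU
    hc_cont hGT_indep hGT_ident herr] with ω hω hωε hωn δ hδ
  have hdisc : ∀ i, TendstoUniformly (fun (m : ℕ) (w : FunctionalMLP.Param W) =>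
      c (T i ω) (FunctionalMLP.discreteOutput F U w m (fun j => X i j ω)
        (fun j => G i ω (X i j ω) + ε i j ω)))
      (fun w => c (T i ω) (FunctionalMLP.output μ F U w (G i ω))) atTop := by
    intro i
    refine FunctionalMLP.tendstoUniformly_error_discreteOutput hF_cont hint hU_cont hB hc_cont _ _
      fun l => ?_
    -- The path's own function `G i ω` is inserted for `g`, and the noise part adds `0` to the
    -- limit.
    simpa only [add_smul, Finset.sum_add_distrib, smul_add, add_zero] using
      (hω i l (G i ω)).add (hωε i l)
  -- The tolerance `η` is split evenly: sampling of functions fixes `N`, then discretization fixes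
  -- `M` for each `n`.
  obtain ⟨η, hη, hclose⟩ := exists_infDist_minimizers_lt hcont hδ
  obtain ⟨N, hN⟩ := eventually_atTop.1 (Metric.tendstoUniformly_iff.1 hωn (η / 2) (half_pos hη))
  refine ⟨N, fun n hn => ?_⟩
  obtain ⟨M, hM⟩ := FunctionalMLP.exists_forall_abs_discreteError_sub_le hdisc n (half_pos hη)
  refine ⟨M, fun m hm => hclose _ fun w => ?_⟩
  have h₁ := hM m hm w
  have h₂ := hN n hn w
  rw [dist_comm, Real.dist_eq] at h₂
  exact (abs_sub_le _ _ _).trans_lt (by linarith)
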